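/- Let $D$ be a ring with one and let $M, L, N$ be (left) $D$-modules. Morphisms and cocycles are composed from left to right: for $\xi\in\operatorname{Ext}^i(A,B)$ and $\zeta\in\operatorname{Ext}^j(B,C)$ the Yoneda product is written $\xi\circ\zeta\in\operatorname{Ext}^{i+j}(A,C)$, where $\operatorname{Ext}^0=\operatorname{Hom}$. Let $\eta^M_L\in\operatorname{Ext}^1(M,L)$ and $\eta^L_N\in\operatorname{Ext}^1(L,N)$. A $2$-extension module with subfactors $M,L,N$ is a $D$-module $E$ with submodules $E\ge E_1\ge E_2\ge 0$ and fixed identifications $E/E_1\cong M$, $E_1/E_2\cong L$, $E_2\cong N$. Let $\operatorname{ExtMod}(\eta^M_L,\eta^L_N)$ be the set of those $2$-extension modules for which $0\to L\to E/E_2\to M\to 0$ has class $\eta^M_L$ and $0\to N\to E_1\to L\to 0$ has class $\eta^L_N$, up to filtered isomorphism, i.e. up to isomorphisms $\alpha:E\to E'$ with $\alpha(E_i)=E_i'$ $(i=1,2)$ which induce the identity on the subfactors $M$, $L$, $N$. If $0\to N\xrightarrow{\iota}G_1\xrightarrow{\pi}L\to0$ is an exact sequence with class $\eta^L_N$, then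 $\operatorname{Ext}^1(M,N)$ acts by $(\xi,x)\mapsto \xi\circ\iota+x$ on the fiber $(\pi_*)^{-1}(\eta^M_L)$ of $\pi_*:\operatorname{Ext}^1(M,G_1)\to\operatorname{Ext}^1(M,L)$; an element $x$ of this fiber induces the $2$-extension modules $E$ for which, after some isomorphism $E_1\cong G_1$ of extensions of $L$ by $N$, the sequence $0\to G_1\to E\to M\to 0$ has class $x$. If $0\to L\xrightarrow{\iota}G_0\xrightarrow{\pi}M\to0$ is an exact sequence with class $\eta^M_L$, then $\operatorname{Ext}^1(M,N)$ acts by $(\xi,y)\mapsto \pi\circ\xi+y$ on the fiber $(\iota^*)^{-1}(\eta^L_N)$ of $\iota^*:\operatorname{Ext}^1(G_0,N)\to\operatorname{Ext}^1(L,N)$; an element $y$ of this fiber induces the $2$-extension modules $E$ for which, after some isomorphism $E/E_2\cong G_0$ of extensions of $M$ by $L$, the sequence $0\to N\to E\to G_0\to 0$ has class $y$. Then: 1. If $\operatorname{ExtMod}(\eta^M_L,\eta^L_N)$ is non-empty, it is a principal homogeneous space for the abelian group $$\operatorname{Ext}^1(\eta^M_L,\eta^L_N):=\operatorname{Ext}^1(M,N)\big/\bigl(\operatorname{Hom}(M,L)\circ\eta^L_N+\eta^M_L\circ\operatorname{Hom}(L,N)\bigr),$$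 under an action that is compatible with the two actions above: for every $G_1$ (respectively $G_0$) as above, if $E$ is induced by $x$ and $E'$ by $\xi\circ\iota+x$ (respectively $E$ by $y$ and $E'$ by $\pi\circ\xi+y$), then the class of $\xi\in\operatorname{Ext}^1(M,N)$ maps the class of $E$ to the class of $E'$. 2. For every such $G_1$ there is a bijection $$\operatorname{ExtMod}(\eta^M_L,\eta^L_N)\cong(\pi_*)^{-1}(\eta^M_L)\big/\bigl(\eta^M_L\circ\operatorname{Hom}(L,N)\bigr)$$ onto the set of orbits of the subgroup $\eta^M_L\circ\operatorname{Hom}(L,N)\le\operatorname{Ext}^1(M,N)$, under which the class of $E$ corresponds to the orbit of $x$ exactly when $E$ is induced by $x$. 3. For every such $G_0$ there is a bijection $$\operatorname{ExtMod}(\eta^M_L,\eta^L_N)\cong(\iota^*)^{-1}(\eta^L_N)\big/\bigl(\operatorname{Hom}(M,L)\circ\eta^L_N\bigr)$$ onto the set of orbits of the subgroup $\operatorname{Hom}(M,L)\circ\eta^L_N\le\operatorname{Ext}^1(M,N)$, under which the class of $E$ corresponds to the orbit of $y$ exactly when $E$ is induced by $y$. -/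

import Mathlib

open CategoryTheory CategoryTheory.Abelian

universe u v

noncomputable section

/-- A `1`-extension `0 ← M ← G ← N ← 0` of `N` with `M`. -/
structure OneExtension {D : Type u} [Ring D] (M N : ModuleCat.{v} D) where
  G : ModuleCat.{v} D
  ι : N ⟶ G
  π : G ⟶ M
  zero : ι ≫ π = 0
  shortExact : (ShortComplex.mk ι π zero).ShortExact

namespace OneExtension

variable {D : Type u} [Ring D] {M N : ModuleCat.{v} D}

/-- The `1`-extension given by an injective linear map `i` and a surjective linear map `p` with
`range i = ker p`. -/
def ofLinearMaps {G : ModuleCat.{v} D} (i : N →ₗ[D] G) (p : G →ₗ[D] M)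
    (hi : Function.Injective i) (hp : Function.Surjective p) (h : Function.Exact i p) :
    OneExtension M N where
  G := G
  ι := ModuleCat.ofHom i
  π := ModuleCat.ofHom p
  zero := by ext x; exact h.apply_apply_eq_zero x
  shortExact := ModuleCat.shortComplex_shortExact _ h hi hp

/-- The `1`-cocycle in `Ext¹(M, N)` corresponding to a `1`-extension of `N` with `M`. -/
def cocycle [Small.{v} D] (X : OneExtension M N) : Ext M N 1 :=
  X.shortExact.extClass

/-- A congruence of `1`-extensions: an isomorphism of the middle modules compatible with the
identities of `N` and `M`. -/
structure Congruence (X Y : OneExtension M N) where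
  iso : X.G ≅ Y.G
  comm_ι : X.ι ≫ iso.hom = Y.ι
  comm_π : iso.hom ≫ Y.π = X.π

end OneExtension

/-- A `2`-extension module `E ≥ E₁ ≥ E₂ ≥ 0` with subfactors `E / E₁ = M`, `E₁ / E₂ = L` and
`E₂ = N`. The identifications with the prescribed modules `M`, `L`, `N` are part of the data. -/
structure TwoExtensionModule {D : Type u} [Ring D] (M L N : ModuleCat.{v} D) where
  E : ModuleCat.{v} D
  E₁ : Submodule D E
  E₂ : Submodule D E
  le : E₂ ≤ E₁
  grM : (E ⧸ E₁) ≃ₗ[D] M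
  grL : (E₁ ⧸ E₂.comap E₁.subtype) ≃ₗ[D] L
  grN : E₂ ≃ₗ[D] N

namespace TwoExtensionModule

variable {D : Type u} [Ring D] {M L N : ModuleCat.{v} D}

/-- The `1`-extension `0 ← M ← E / E₂ ← L ← 0`, where `L = E₁ / E₂`. -/
def G₀ (A : TwoExtensionModule M L N) : OneExtension M L :=
  OneExtension.ofLinearMaps (G := ModuleCat.of D (A.E ⧸ A.E₂))
    (((A.E₂.comap A.E₁.subtype).mapQ A.E₂ A.E₁.subtype le_rfl).comp A.grL.symm.toLinearMap)
    (A.grM.toLinearMap.comp (Submodule.factor A.le))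
    (by
      rw [LinearMap.coe_comp]
      refine Function.Injective.comp (g := (A.E₂.comap A.E₁.subtype).mapQ A.E₂ A.E₁.subtype le_rfl)
        ?_ A.grL.symm.injective
      rw [← LinearMap.ker_eq_bot, Submodule.ker_mapQ, Submodule.mkQ_map_self])
    (A.grM.surjective.comp (Submodule.factor_surjective A.le))
    (by
      intro y
      obtain ⟨e, rfl⟩ := Submodule.Quotient.mk_surjective _ y
      constructor
      · intro h
        have h1 : e ∈ A.E₁ := by simpa using h
        refine ⟨A.grL (Submodule.Quotient.mk ⟨e, h1⟩), ?_⟩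
        rw [LinearMap.comp_apply, LinearEquiv.coe_coe, LinearEquiv.symm_apply_apply]
        rfl
      · rintro ⟨l, hl⟩
        obtain ⟨z, rfl⟩ := A.grL.surjective l
        obtain ⟨z, rfl⟩ := Submodule.Quotient.mk_surjective _ z
        rw [LinearMap.comp_apply, LinearEquiv.coe_coe, LinearEquiv.symm_apply_apply] at hl
        rw [← hl]
        change A.grM (Submodule.Quotient.mk (z : A.E)) = 0
        rw [(Submodule.Quotient.mk_eq_zero A.E₁).2 z.2, map_zero])

/-- The `1`-extension `0 ← L ← E₁ ← N ← 0`, where `N = E₂`. -/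
def G₁ (A : TwoExtensionModule M L N) : OneExtension L N :=
  OneExtension.ofLinearMaps (G := ModuleCat.of D A.E₁)
    ((Submodule.inclusion A.le).comp A.grN.symm.toLinearMap)
    (A.grL.toLinearMap.comp (A.E₂.comap A.E₁.subtype).mkQ)
    ((Submodule.inclusion_injective A.le).comp A.grN.symm.injective)
    (A.grL.surjective.comp (Submodule.mkQ_surjective _))
    (by
      intro y
      change A.grL (Submodule.Quotient.mk y) = 0 ↔ _
      rw [LinearEquiv.map_eq_zero_iff, Submodule.Quotient.mk_eq_zero]
      constructor
      · intro h
        exact ⟨A.grN ⟨y, h⟩, by ext; simp⟩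
      · rintro ⟨n, rfl⟩
        exact (A.grN.symm n).2)

/-- The `1`-extension `0 ← M ← E ← E₁ ← 0`. -/
def upper (A : TwoExtensionModule M L N) : OneExtension M (ModuleCat.of D A.E₁) :=
  OneExtension.ofLinearMaps (G := A.E) A.E₁.subtype (A.grM.toLinearMap.comp A.E₁.mkQ)
    A.E₁.subtype_injective (A.grM.surjective.comp A.E₁.mkQ_surjective)
    (by intro y; simp)

/-- The `1`-extension `0 ← E / E₂ ← E ← N ← 0`. -/
def lower (A : TwoExtensionModule M L N) : OneExtension (ModuleCat.of D (A.E ⧸ A.E₂)) N :=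
  OneExtension.ofLinearMaps (G := A.E) (A.E₂.subtype.comp A.grN.symm.toLinearMap) A.E₂.mkQ
    (A.E₂.subtype_injective.comp A.grN.symm.injective) A.E₂.mkQ_surjective
    (by
      intro y
      constructor
      · intro h
        have h2 : y ∈ A.E₂ := by simpa using h
        exact ⟨A.grN ⟨y, h2⟩, by simp⟩
      · rintro ⟨n, rfl⟩
        simp)

/-- A filtered isomorphism `α : E ≅ E'`: it restricts to isomorphisms `Eᵢ ≅ E'ᵢ`, and the
isomorphisms it induces on the subfactors are the identities of `M`, `L` and `N`. -/
structure FilteredIso (A B : TwoExtensionModule M L N) where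
  α : A.E ≃ₗ[D] B.E
  mem₁ : ∀ e, α e ∈ B.E₁ ↔ e ∈ A.E₁
  mem₂ : ∀ e, α e ∈ B.E₂ ↔ e ∈ A.E₂
  grM_eq : ∀ e, B.grM (Submodule.Quotient.mk (α e)) = A.grM (Submodule.Quotient.mk e)
  grL_eq : ∀ (e : A.E) (he : e ∈ A.E₁),
    B.grL (Submodule.Quotient.mk ⟨α e, (mem₁ e).2 he⟩) = A.grL (Submodule.Quotient.mk ⟨e, he⟩)
  grN_eq : ∀ (e : A.E) (he : e ∈ A.E₂), B.grN ⟨α e, (mem₂ e).2 he⟩ = A.grN ⟨e, he⟩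

def FilteredIso.refl (A : TwoExtensionModule M L N) : FilteredIso A A where
  α := LinearEquiv.refl D A.E
  mem₁ _ := Iff.rfl
  mem₂ _ := Iff.rfl
  grM_eq _ := rfl
  grL_eq _ _ := rfl
  grN_eq _ _ := rfl

def FilteredIso.symm {A B : TwoExtensionModule M L N} (f : FilteredIso A B) :
    FilteredIso B A where
  α := f.α.symm
  mem₁ e := by rw [← f.mem₁, LinearEquiv.apply_symm_apply]
  mem₂ e := by rw [← f.mem₂, LinearEquiv.apply_symm_apply]
  grM_eq e := by rw [← f.grM_eq, LinearEquiv.apply_symm_apply]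
  grL_eq e he := by
    rw [← f.grL_eq]
    simp only [LinearEquiv.apply_symm_apply]
  grN_eq e he := by
    rw [← f.grN_eq]
    simp only [LinearEquiv.apply_symm_apply]

def FilteredIso.trans {A B C : TwoExtensionModule M L N} (f : FilteredIso A B)
    (g : FilteredIso B C) : FilteredIso A C where
  α := f.α.trans g.α
  mem₁ e := (g.mem₁ _).trans (f.mem₁ e)
  mem₂ e := (g.mem₂ _).trans (f.mem₂ e)
  grM_eq e := (g.grM_eq _).trans (f.grM_eq e)
  grL_eq e he := (g.grL_eq _ ((f.mem₁ e).2 he)).trans (f.grL_eq e he)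
  grN_eq e he := (g.grN_eq _ ((f.mem₂ e).2 he)).trans (f.grN_eq e he)

end TwoExtensionModule

section Cocycles

variable {D : Type u} [Ring D] [Small.{v} D] {M L N : ModuleCat.{v} D}

/-- The `2`-extension modules whose `1`-extensions `G₀` and `G₁` correspond to the cocycles `η`
and `η'`. -/
def AdmissibleModule (η : Ext M L 1) (η' : Ext L N 1) :=
  {A : TwoExtensionModule M L N // A.G₀.cocycle = η ∧ A.G₁.cocycle = η'}

instance admissibleSetoid (η : Ext M L 1) (η' : Ext L N 1) : Setoid (AdmissibleModule η η') where
  r A B := Nonempty (TwoExtensionModule.FilteredIso A.1 B.1)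
  iseqv :=
    { refl := fun A => ⟨.refl A.1⟩
      symm := fun ⟨f⟩ => ⟨f.symm⟩
      trans := fun ⟨f⟩ ⟨g⟩ => ⟨f.trans g⟩ }

/-- `ExtMod(η, η')`: admissible `2`-extension modules up to filtered isomorphism. -/
def ExtMod (η : Ext M L 1) (η' : Ext L N 1) := Quotient (admissibleSetoid η η')

/-- The class in `ExtMod(η, η')` of an admissible `2`-extension module. -/
def ExtMod.mk {η : Ext M L 1} {η' : Ext L N 1} (A : AdmissibleModule η η') : ExtMod η η' :=
  Quotient.mk _ A

/-- The subgroup `Hom(M, L) ∘ η'` of `Ext¹(M, N)`. (`Ext.comp` composes in diagrammatic order.) -/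
def homComp (M : ModuleCat.{v} D) (η' : Ext L N 1) : AddSubgroup (Ext M N 1) :=
  AddMonoidHom.range (AddMonoidHom.mk' (fun φ : M ⟶ L => (Ext.mk₀ φ).comp η' (zero_add 1))
    (fun a b => by rw [Ext.mk₀_add, Ext.add_comp]))

/-- The subgroup `η ∘ Hom(L, N)` of `Ext¹(M, N)`. -/
def compHom (η : Ext M L 1) (N : ModuleCat.{v} D) : AddSubgroup (Ext M N 1) :=
  AddMonoidHom.range (AddMonoidHom.mk' (fun ψ : L ⟶ N => η.comp (Ext.mk₀ ψ) (add_zero 1))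
    (fun a b => by rw [Ext.mk₀_add, Ext.comp_add]))

/-- The first extension group of `1`-cocycles,
`Ext¹(η, η') = Ext¹(M, N) / (Hom(M, L) ∘ η' + η ∘ Hom(L, N))`. -/
abbrev ExtOfCocycles (η : Ext M L 1) (η' : Ext L N 1) :=
  Ext M N 1 ⧸ (homComp M η' ⊔ compHom η N)

/-- The fiber over `η` of `π_* : Ext¹(M, G₁) → Ext¹(M, L)`. -/
def PushFiber (G₁ : OneExtension L N) (η : Ext M L 1) :=
  {x : Ext M G₁.G 1 // x.comp (Ext.mk₀ G₁.π) (add_zero 1) = η}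

/-- `Ext¹(M, N)` acts on the fiber of `π_*` by `(ξ, x) ↦ ι_* ξ + x`. -/
instance (G₁ : OneExtension L N) (η : Ext M L 1) :
    AddAction (Ext M N 1) (PushFiber G₁ η) where
  vadd ξ x := ⟨ξ.comp (Ext.mk₀ G₁.ι) (add_zero 1) + x.1, by
    rw [Ext.add_comp, x.2, Ext.comp_assoc_of_third_deg_zero, Ext.mk₀_comp_mk₀, G₁.zero,
      Ext.mk₀_zero, Ext.comp_zero, zero_add]⟩
  zero_vadd x := Subtype.ext (by
    change (0 : Ext M N 1).comp (Ext.mk₀ G₁.ι) (add_zero 1) + x.1 = x.1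
    rw [Ext.zero_comp, zero_add])
  add_vadd ξ ξ' x := Subtype.ext (by
    change (ξ + ξ').comp (Ext.mk₀ G₁.ι) (add_zero 1) + x.1 =
      ξ.comp (Ext.mk₀ G₁.ι) (add_zero 1) + (ξ'.comp (Ext.mk₀ G₁.ι) (add_zero 1) + x.1)
    rw [Ext.add_comp, add_assoc])

/-- The fiber over `η'` of `ι^* : Ext¹(G₀, N) → Ext¹(L, N)`. -/
def PullFiber (G₀ : OneExtension M L) (η' : Ext L N 1) :=
  {y : Ext G₀.G N 1 // (Ext.mk₀ G₀.ι).comp y (zero_add 1) = η'}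

/-- `Ext¹(M, N)` acts on the fiber of `ι^*` by `(ξ, y) ↦ π^* ξ + y`. -/
instance (G₀ : OneExtension M L) (η' : Ext L N 1) :
    AddAction (Ext M N 1) (PullFiber G₀ η') where
  vadd ξ y := ⟨(Ext.mk₀ G₀.π).comp ξ (zero_add 1) + y.1, by
    rw [Ext.comp_add, y.2, Ext.mk₀_comp_mk₀_assoc, G₀.zero, Ext.mk₀_zero, Ext.zero_comp,
      zero_add]⟩
  zero_vadd y := Subtype.ext (by
    change (Ext.mk₀ G₀.π).comp (0 : Ext M N 1) (zero_add 1) + y.1 = y.1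
    rw [Ext.comp_zero, zero_add])
  add_vadd ξ ξ' y := Subtype.ext (by
    change (Ext.mk₀ G₀.π).comp (ξ + ξ') (zero_add 1) + y.1 =
      (Ext.mk₀ G₀.π).comp ξ (zero_add 1) + ((Ext.mk₀ G₀.π).comp ξ' (zero_add 1) + y.1)
    rw [Ext.comp_add, add_assoc])

/-- The `1`-extension `0 ← M ← E ← G₁ ← 0`, obtained from `0 ← M ← E ← E₁ ← 0` through a
congruence between `G₁` and `0 ← L ← E₁ ← N ← 0`, has the class `x`. In other words, `E` is the
`2`-extension module which `x` induces. -/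
def InducedByPush (G₁ : OneExtension L N) (A : TwoExtensionModule M L N) (x : Ext M G₁.G 1) :
    Prop :=
  ∃ e : OneExtension.Congruence G₁ A.G₁,
    x.comp (Ext.mk₀ e.iso.hom) (add_zero 1) = A.upper.cocycle

/-- The `1`-extension `0 ← G₀ ← E ← N ← 0`, obtained from `0 ← E / E₂ ← E ← N ← 0` through a
congruence between `0 ← M ← E / E₂ ← L ← 0` and `G₀`, has the class `y`. -/
def InducedByPull (G₀ : OneExtension M L) (A : TwoExtensionModule M L N) (y : Ext G₀.G N 1) :
    Prop :=
  ∃ e : OneExtension.Congruence A.G₀ G₀,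
    (Ext.mk₀ e.iso.hom).comp y (zero_add 1) = A.lower.cocycle

end Cocycles

end

/-! Extensions are traded for classes in `Ext`: every class in `Ext¹` is realised by an extension
(`exists_cocycle_eq`), and maps of the outer terms extend to the middle terms exactly when they
intertwine the classes (`cocycle_naturality`, `exists_hom_of_cocycle_comp_eq`). A 2-extension module
`E` is thereby an extension of `M` by `E₁` whose class maps to `η` in `Ext¹(M, L)`, or dually an
extension of `E / E₂` by `N` whose class restricts to `η'` on `L`.

Up to filtered isomorphism, `E` is then a class `x` in the fiber over `η`, modulo the choice of a
congruence `E₁ ≅ G₁`. Two congruences differ by `π ≫ ψ ≫ ι` with `ψ : L ⟶ N`, which moves `x` by `(η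
∘ ψ) ∘ ι`; this is the quotient by `η ∘ Hom(L, N)`. The pull side is dual.

For the torsor, two classes in the fiber differ by some `ξ ∘ ι`, by the long exact sequence.
Translation by `ξ` fixes `E` exactly when `(ξ + η ∘ ψ) ∘ ι = 0` for some `ψ`, and the kernel of
`ι_*` is `Hom(M, L) ∘ η'` (`IsTranslate.self_iff`).

It remains to see that the two fibers induce the same action (`isTranslate_of_pull`). If `X`
realises `ξ`, the fiber product of `E` and `X` over `M` is an extension both of `M` by `E₁ × N` and
of `E / E₂` by `N × N`. A single map out of it, found on the second side by a Baer sum, is read off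
on the first. -/

noncomputable section

/-! ### 1-extensions, their classes and their congruences -/

namespace OneExtension

variable {D : Type u} [Ring D] {M N M' N' : ModuleCat.{v} D}

lemma ι_injective (X : OneExtension M N) : Function.Injective X.ι :=
  X.shortExact.moduleCat_injective_f

lemma π_surjective (X : OneExtension M N) : Function.Surjective X.π :=
  X.shortExact.moduleCat_surjective_g

lemma exact (X : OneExtension M N) : Function.Exact X.ι X.π :=
  (ShortComplex.ShortExact.moduleCat_exact_iff_function_exact _).1 X.shortExact.exact

@[simp]
lemma π_ι (X : OneExtension M N) (n : N) : X.π (X.ι n) = 0 :=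
  X.exact.apply_apply_eq_zero n

/-- A commutative ladder between `1`-extensions intertwines their cocycles. -/
lemma cocycle_naturality [Small.{v} D] (X : OneExtension M N) (Y : OneExtension M' N')
    (f : N ⟶ N') (φ : X.G ⟶ Y.G) (g : M ⟶ M') (hι : f ≫ Y.ι = X.ι ≫ φ)
    (hπ : φ ≫ Y.π = X.π ≫ g) :
    X.cocycle.comp (Ext.mk₀ f) (add_zero 1) = (Ext.mk₀ g).comp Y.cocycle (zero_add 1) :=
  ShortComplex.ShortExact.extClass_naturality X.shortExact Y.shortExact
    { τ₁ := f, τ₂ := φ, τ₃ := g, comm₁₂ := hι, comm₂₃ := hπ }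

/-- Morphisms of the outer terms which intertwine the cocycles extend to the middle terms. -/
lemma exists_hom_of_cocycle_comp_eq [Small.{v} D] (X : OneExtension M N)
    (Y : OneExtension M' N') (f : N ⟶ N') (g : M ⟶ M')
    (h : X.cocycle.comp (Ext.mk₀ f) (add_zero 1) =
      (Ext.mk₀ g).comp Y.cocycle (zero_add 1)) :
    ∃ φ : X.G ⟶ Y.G, f ≫ Y.ι = X.ι ≫ φ ∧ φ ≫ Y.π = X.π ≫ g := by
  -- The obstruction to extending `f ≫ Y.ι` along `X.ι` is the class of `X` pushed along it; by `h`
  -- this passes through `Y.cocycle` followed by `Y.ι`, which vanishes.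
  obtain ⟨φ₀, hφ₀⟩ := Ext.contravariant_sequence_exact₁ X.shortExact Y.G
    (Ext.mk₀ (f ≫ Y.ι)) (add_zero 1) (by
      change X.cocycle.comp _ _ = 0
      rw [← Ext.mk₀_comp_mk₀, ← Ext.comp_assoc_of_third_deg_zero, h,
        Ext.comp_assoc_of_third_deg_zero]
      erw [Y.shortExact.extClass_comp]
      rw [Ext.comp_zero])
  obtain ⟨φ, rfl⟩ := (Ext.mk₀_bijective _ _).2 φ₀
  change (Ext.mk₀ X.ι).comp _ _ = _ at hφ₀
  rw [Ext.mk₀_comp_mk₀] at hφ₀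
  replace hφ₀ : X.ι ≫ φ = f ≫ Y.ι := (Ext.mk₀_bijective _ _).1 hφ₀
  have := X.shortExact.epi_g
  have hz : X.ι ≫ φ ≫ Y.π = 0 := by
    rw [← Category.assoc, hφ₀, Category.assoc, Y.zero, Limits.comp_zero]
  let g' : M ⟶ M' := X.shortExact.exact.desc (φ ≫ Y.π) hz
  have hg' : X.π ≫ g' = φ ≫ Y.π := X.shortExact.exact.g_desc _ hz
  have hn := X.cocycle_naturality Y f φ g' hφ₀.symm hg'.symm
  -- The extension `φ` may induce a wrong map `g'` on the quotients. Both `g'` and `g` pull the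
  -- class of `Y` back to the same class, so `g' - g` lifts to some `k : M ⟶ Y.G`, and subtracting
  -- `X.π ≫ k` from `φ` corrects it.
  obtain ⟨k₀, hk₀⟩ := Ext.covariant_sequence_exact₃ M Y.shortExact (Ext.mk₀ (g' - g))
    (zero_add 1) (by
      change (Ext.mk₀ _).comp Y.cocycle _ = 0
      rw [sub_eq_add_neg, Ext.mk₀_add, Ext.mk₀_neg, Ext.add_comp, Ext.neg_comp, ← hn, ← h,
        add_neg_cancel])
  obtain ⟨k, rfl⟩ := (Ext.mk₀_bijective _ _).2 k₀
  change (Ext.mk₀ k).comp (Ext.mk₀ Y.π) _ = _ at hk₀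
  rw [Ext.mk₀_comp_mk₀] at hk₀
  replace hk₀ : k ≫ Y.π = g' - g := (Ext.mk₀_bijective _ _).1 hk₀
  refine ⟨φ - X.π ≫ k, ?_, ?_⟩
  · rw [Preadditive.comp_sub, ← Category.assoc X.ι X.π k, X.zero, Limits.zero_comp, sub_zero,
      hφ₀]
  · rw [Preadditive.sub_comp, Category.assoc, hk₀, ← hg', Preadditive.comp_sub]
    abel

/-- The pullback of a `1`-extension along a linear map. -/
def pullback (Y : OneExtension M' N) (g : M ⟶ M') : OneExtension M N :=
  ofLinearMaps (M := M) (N := N)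
    (G := ModuleCat.of D (LinearMap.eqLocus (g.hom.comp (LinearMap.fst D M Y.G))
      (Y.π.hom.comp (LinearMap.snd D M Y.G))))
    ((LinearMap.inr D M Y.G ∘ₗ Y.ι.hom).codRestrict _ (fun n => by simp))
    (LinearMap.fst D M Y.G ∘ₗ Submodule.subtype _)
    (by
      intro a b hab
      apply Y.ι_injective
      exact congrArg (fun z => z.1.2) hab)
    (by
      intro m
      obtain ⟨y, hy⟩ := Y.π_surjective (g m)
      exact ⟨⟨(m, y), hy.symm⟩, rfl⟩)
    (by
      rintro ⟨⟨m, y⟩, h⟩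
      replace h : g m = Y.π y := h
      constructor
      · intro hm
        replace hm : m = 0 := hm
        subst hm
        obtain ⟨n, rfl⟩ := (Y.exact y).1 (by rw [← h, map_zero])
        exact ⟨n, rfl⟩
      · rintro ⟨n, hn⟩
        exact (congrArg (fun z => z.1.1) hn).symm)

lemma pullback_cocycle [Small.{v} D] (Y : OneExtension M' N) (g : M ⟶ M') :
    (Y.pullback g).cocycle = (Ext.mk₀ g).comp Y.cocycle (zero_add 1) := by
  rw [← cocycle_naturality (Y.pullback g) Y (𝟙 N)
    (ModuleCat.ofHom (LinearMap.snd D M Y.G ∘ₗ Submodule.subtype _)) g rfl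
    (by ext z; exact z.2.symm), Ext.comp_mk₀_id]

/-- Every class in `Ext¹(M, N)` is the cocycle of a `1`-extension. -/
lemma exists_cocycle_eq [Small.{v} D] (x : Ext M N 1) : ∃ X : OneExtension M N, X.cocycle = x := by
  -- Since `N` embeds in an injective, the connecting map from homomorphisms into the cokernel is
  -- onto `Ext¹(M, N)`; it is realised by pulling back `Y`.
  let Y : OneExtension (Limits.cokernel (Injective.ι N)) N :=
    { G := Injective.under N
      ι := Injective.ι N
      π := Limits.cokernel.π _
      zero := Limits.cokernel.condition _
      shortExact := { exact := ShortComplex.exact_cokernel _ } }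
  obtain ⟨g₀, hg₀⟩ := Ext.covariant_sequence_exact₁ M Y.shortExact x
    (Ext.eq_zero_of_injective (I := Injective.under N) _) (zero_add 1)
  obtain ⟨g, rfl⟩ := (Ext.mk₀_bijective _ _).2 g₀
  exact ⟨Y.pullback g, (Y.pullback_cocycle g).trans hg₀⟩

/-- A morphism of `1`-extensions over isomorphisms of the outer terms is an isomorphism. -/
lemma isIso_of_comm (X : OneExtension M N) (Y : OneExtension M' N') (f : N ⟶ N')
    (φ : X.G ⟶ Y.G) (g : M ⟶ M') (hι : f ≫ Y.ι = X.ι ≫ φ) (hπ : φ ≫ Y.π = X.π ≫ g)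
    [IsIso f] [IsIso g] : IsIso φ :=
  ShortComplex.isIso₂_of_shortExact_of_isIso₁₃
    (S₁ := ShortComplex.mk X.ι X.π X.zero) (S₂ := ShortComplex.mk Y.ι Y.π Y.zero)
    { τ₁ := f, τ₂ := φ, τ₃ := g, comm₁₂ := hι, comm₂₃ := hπ } X.shortExact Y.shortExact

namespace Congruence

variable {X Y Z : OneExtension M N}

/-- A morphism of `1`-extensions which is the identity on the outer terms is a congruence. -/
def ofHom (φ : X.G ⟶ Y.G) (hι : X.ι ≫ φ = Y.ι) (hπ : φ ≫ Y.π = X.π) : Congruence X Y :=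
  have := isIso_of_comm X Y (𝟙 N) φ (𝟙 M) (by simp [hι]) (by simp [hπ])
  ⟨asIso φ, hι, hπ⟩

def symm (e : Congruence X Y) : Congruence Y X where
  iso := e.iso.symm
  comm_ι := by simp [← e.comm_ι]
  comm_π := by simp [← e.comm_π]

def trans (e : Congruence X Y) (e' : Congruence Y Z) : Congruence X Z where
  iso := e.iso ≪≫ e'.iso
  comm_ι := by rw [Iso.trans_hom, ← Category.assoc, e.comm_ι, e'.comm_ι]
  comm_π := by rw [Iso.trans_hom, Category.assoc, e'.comm_π, e.comm_π]

lemma hom_ι (e : Congruence X Y) (n : N) : e.iso.hom (X.ι n) = Y.ι n :=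
  congrArg (fun f : N ⟶ Y.G => f n) e.comm_ι

lemma π_hom (e : Congruence X Y) (z : X.G) : Y.π (e.iso.hom z) = X.π z :=
  congrArg (fun f : X.G ⟶ M => f z) e.comm_π

/-- Two congruences differ by a morphism from the quotient to the submodule. -/
lemma exists_eq_add (e e' : Congruence X Y) :
    ∃ ψ : M ⟶ N, e'.iso.hom = e.iso.hom + X.π ≫ ψ ≫ Y.ι := by
  have := X.shortExact.epi_g
  have := Y.shortExact.mono_f
  have h₁ : (e'.iso.hom - e.iso.hom) ≫ Y.π = 0 := by
    rw [Preadditive.sub_comp, e.comm_π, e'.comm_π, sub_self]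
  let k : X.G ⟶ N := Y.shortExact.exact.lift (e'.iso.hom - e.iso.hom) h₁
  have hk : k ≫ Y.ι = e'.iso.hom - e.iso.hom := Y.shortExact.exact.lift_f _ h₁
  have h₂ : X.ι ≫ k = 0 := by
    apply (cancel_mono Y.ι).1
    rw [Category.assoc, hk, Preadditive.comp_sub, e.comm_ι, e'.comm_ι, sub_self,
      Limits.zero_comp]
  have h₃ : X.π ≫ X.shortExact.exact.desc k h₂ = k := X.shortExact.exact.g_desc _ h₂
  refine ⟨X.shortExact.exact.desc k h₂, ?_⟩
  rw [← Category.assoc, h₃, hk, add_sub_cancel]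

/-- Adding a morphism from the quotient to the submodule to a congruence. -/
def addHom (e : Congruence X Y) (ψ : M ⟶ N) : Congruence X Y :=
  ofHom (e.iso.hom + X.π ≫ ψ ≫ Y.ι)
    (by rw [Preadditive.comp_add, e.comm_ι, ← Category.assoc X.ι, X.zero, Limits.zero_comp,
      add_zero])
    (by simp [Preadditive.add_comp, e.comm_π, Y.zero])

end Congruence

/-- `1`-extensions with the same cocycle are congruent. -/
lemma nonempty_congruence [Small.{v} D] {X Y : OneExtension M N} (h : X.cocycle = Y.cocycle) :
    Nonempty (Congruence X Y) := by
  obtain ⟨φ, hι, hπ⟩ := X.exists_hom_of_cocycle_comp_eq Y (𝟙 N) (𝟙 M)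
    (by rw [h, Ext.comp_mk₀_id, Ext.mk₀_id_comp])
  exact ⟨.ofHom φ (by rw [← hι, Category.id_comp]) (by rw [hπ, Category.comp_id])⟩

end OneExtension

/-! ### Filtered isomorphisms in terms of extension classes -/

namespace TwoExtensionModule

variable {D : Type u} [Ring D] {M L N : ModuleCat.{v} D} {A B : TwoExtensionModule M L N}

/-- The extension `A.upper`, as an extension of `M` by the middle term of `A.G₁`. -/
def pushExtension (A : TwoExtensionModule M L N) : OneExtension M A.G₁.G := A.upper

/-- The extension `A.lower`, as an extension of the middle term of `A.G₀` by `N`. -/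
def pullExtension (A : TwoExtensionModule M L N) : OneExtension A.G₀.G N := A.lower

/-- The projection of `E` onto the middle term `E / E₂` of `A.G₀`. -/
def toG₀ (A : TwoExtensionModule M L N) : A.E ⟶ A.G₀.G := A.lower.π

lemma G₀_π_toG₀ (A : TwoExtensionModule M L N) (e : A.E) :
    A.G₀.π (A.toG₀ e) = A.grM (Submodule.Quotient.mk e) := rfl

lemma G₀_ι_grL (A : TwoExtensionModule M L N) (z : A.E₁) :
    A.G₀.ι (A.grL (Submodule.Quotient.mk z)) = A.toG₀ z.1 := by
  change (A.E₂.comap A.E₁.subtype).mapQ A.E₂ A.E₁.subtype le_rfl (A.grL.symm (A.grL _)) = _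
  rw [LinearEquiv.symm_apply_apply]
  rfl

lemma mem_E₁_iff (A : TwoExtensionModule M L N) (e : A.E) :
    e ∈ A.E₁ ↔ A.grM (Submodule.Quotient.mk e) = 0 := by
  rw [LinearEquiv.map_eq_zero_iff, Submodule.Quotient.mk_eq_zero]

lemma mem_E₂_iff (A : TwoExtensionModule M L N) (z : A.E₁) :
    z.1 ∈ A.E₂ ↔ A.grL (Submodule.Quotient.mk z) = 0 := by
  rw [LinearEquiv.map_eq_zero_iff, Submodule.Quotient.mk_eq_zero]
  rfl

/-- A linear map which respects the filtrations and induces the identities on the subfactors is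
bijective, hence a filtered isomorphism. -/
lemma nonempty_filteredIso_of_linearMap (φ : A.E →ₗ[D] B.E)
    (hM : ∀ e, B.grM (Submodule.Quotient.mk (φ e)) = A.grM (Submodule.Quotient.mk e))
    (hL : ∀ (e : A.E) (he : e ∈ A.E₁), ∃ h : φ e ∈ B.E₁,
      B.grL (Submodule.Quotient.mk ⟨φ e, h⟩) = A.grL (Submodule.Quotient.mk ⟨e, he⟩))
    (hN : ∀ n : N, φ (A.grN.symm n) = B.grN.symm n) : Nonempty (FilteredIso A B) := by
  -- `E₁` is the kernel of the map to `M` and, inside `E₁`, `E₂` is the kernel of the map to `L`.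
  -- Hence inducing identities on the subfactors makes `φ` reflect the filtration as well as
  -- preserve it.
  have mem₁ : ∀ e, φ e ∈ B.E₁ ↔ e ∈ A.E₁ := fun e => by
    rw [mem_E₁_iff, mem_E₁_iff, hM]
  have mem₂ : ∀ e, φ e ∈ B.E₂ ↔ e ∈ A.E₂ := by
    have key : ∀ e (he : e ∈ A.E₁), φ e ∈ B.E₂ ↔ e ∈ A.E₂ := fun e he => by
      obtain ⟨h, h'⟩ := hL e he
      rw [A.mem_E₂_iff ⟨e, he⟩, ← h', ← mem_E₂_iff]
    exact fun e => ⟨fun h => (key e ((mem₁ e).1 (B.le h))).1 h, fun h => (key e (A.le h)).2 h⟩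
  have grN_eq : ∀ (e : A.E) (he : e ∈ A.E₂), B.grN ⟨φ e, (mem₂ e).2 he⟩ = A.grN ⟨e, he⟩ := by
    intro e he
    rw [← LinearEquiv.eq_symm_apply]
    ext
    rw [← hN, LinearEquiv.symm_apply_apply]
  have inj : Function.Injective φ := by
    rw [injective_iff_map_eq_zero]
    intro e he
    -- The kernel of `φ` lies in `E₂`, where `φ` is the identity of `N`.
    have h₂ : e ∈ A.E₂ := (mem₂ e).1 (by rw [he]; exact zero_mem _)
    have h := grN_eq e h₂
    have h0 : (⟨φ e, (mem₂ e).2 h₂⟩ : B.E₂) = 0 := Subtype.ext he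
    rw [h0, map_zero, eq_comm, LinearEquiv.map_eq_zero_iff] at h
    exact congrArg Subtype.val h
  -- Surjectivity climbs the filtration: a preimage modulo one step is corrected by a preimage in
  -- that step.
  have surj₂ : ∀ b ∈ B.E₂, ∃ e, φ e = b := fun b hb =>
    ⟨A.grN.symm (B.grN ⟨b, hb⟩), by rw [hN, LinearEquiv.symm_apply_apply]⟩
  have surj₁ : ∀ b ∈ B.E₁, ∃ e, φ e = b := by
    intro b hb
    obtain ⟨z, hz⟩ := A.grL.surjective (B.grL (Submodule.Quotient.mk ⟨b, hb⟩))
    obtain ⟨⟨e, he⟩, rfl⟩ := Submodule.Quotient.mk_surjective _ z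
    obtain ⟨h, h'⟩ := hL e he
    rw [← h'] at hz
    have h₂ : b - φ e ∈ B.E₂ := by
      have := (Submodule.Quotient.eq _).1 (B.grL.injective hz.symm)
      exact this
    obtain ⟨e', he'⟩ := surj₂ _ h₂
    exact ⟨e' + e, by rw [map_add, he', sub_add_cancel]⟩
  have surj : Function.Surjective φ := by
    intro b
    obtain ⟨z, hz⟩ := A.grM.surjective (B.grM (Submodule.Quotient.mk b))
    obtain ⟨e, rfl⟩ := Submodule.Quotient.mk_surjective _ z
    rw [← hM] at hz
    obtain ⟨e', he'⟩ := surj₁ _ ((Submodule.Quotient.eq _).1 (B.grM.injective hz.symm))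
    exact ⟨e' + e, by rw [map_add, he', sub_add_cancel]⟩
  exact ⟨⟨LinearEquiv.ofBijective φ ⟨inj, surj⟩, mem₁, mem₂, hM, fun e he => (hL e he).2, grN_eq⟩⟩

/-- `L` embeds in `E / E₂` through `G₀.ι`, so the image in `L` of an element of `E₁` can be tested
modulo `E₂`. A congruence of the quotients thus controls the subfactor `L`. -/
lemma grL_eq_of_congruence (g : OneExtension.Congruence A.G₀ B.G₀) {a : A.E} {b : B.E}
    (h : B.toG₀ b = g.iso.hom (A.toG₀ a)) (ha : a ∈ A.E₁) :
    ∃ hb : b ∈ B.E₁,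
      B.grL (Submodule.Quotient.mk ⟨b, hb⟩) = A.grL (Submodule.Quotient.mk ⟨a, ha⟩) := by
  have hM : B.grM (Submodule.Quotient.mk b) = A.grM (Submodule.Quotient.mk a) := by
    rw [← G₀_π_toG₀, h, g.π_hom, G₀_π_toG₀]
  have hb : b ∈ B.E₁ := by rwa [mem_E₁_iff, hM, ← mem_E₁_iff]
  refine ⟨hb, B.G₀.ι_injective ?_⟩
  rw [G₀_ι_grL, ← g.hom_ι, G₀_ι_grL, h]

variable [Small.{v} D]

/-- The quotient map `E → E / E₂` is a ladder over `E₁ → L` and the identity of `M`; this places the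
class of `E` in the fiber of `π_*`. -/
lemma pushExtension_cocycle_comp (A : TwoExtensionModule M L N) :
    A.pushExtension.cocycle.comp (Ext.mk₀ A.G₁.π) (add_zero 1) = A.G₀.cocycle := by
  rw [A.pushExtension.cocycle_naturality A.G₀ A.G₁.π (ModuleCat.ofHom A.E₂.mkQ) (𝟙 M)
    (by ext z; exact A.G₀_ι_grL z) rfl, Ext.mk₀_id_comp]

/-- Dually, the inclusion `E₁ → E` is a ladder over the identity of `N` and `L → E / E₂`. -/
lemma comp_pullExtension_cocycle (A : TwoExtensionModule M L N) :
    (Ext.mk₀ A.G₀.ι).comp A.pullExtension.cocycle (zero_add 1) = A.G₁.cocycle := by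
  rw [← A.G₁.cocycle_naturality A.pullExtension (𝟙 N) (ModuleCat.ofHom A.E₁.subtype) A.G₀.ι rfl
    (by ext z; exact (A.G₀_ι_grL z).symm), Ext.comp_mk₀_id]

/-- Filtered isomorphism in terms of the extensions `0 ← M ← E ← E₁ ← 0`. -/
lemma nonempty_filteredIso_iff_push : Nonempty (FilteredIso A B) ↔
    ∃ c : OneExtension.Congruence A.G₁ B.G₁,
      A.pushExtension.cocycle.comp (Ext.mk₀ c.iso.hom) (add_zero 1) = B.pushExtension.cocycle := by
  constructor
  · rintro ⟨f⟩
    let φ : A.G₁.G ⟶ B.G₁.G := ModuleCat.ofHom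
      ((f.α.toLinearMap ∘ₗ A.E₁.subtype).codRestrict B.E₁ (fun z => (f.mem₁ _).2 z.2))
    refine ⟨.ofHom φ ?_ ?_, ?_⟩
    · ext n
      refine Subtype.ext (?_ : f.α (A.grN.symm n).1 = (B.grN.symm n).1)
      have := f.grN_eq _ (A.grN.symm n).2
      rw [← LinearEquiv.eq_symm_apply] at this
      simpa using congrArg Subtype.val this
    · ext z
      exact f.grL_eq z.1 z.2
    · refine (A.pushExtension.cocycle_naturality B.pushExtension φ (ModuleCat.ofHom f.α.toLinearMap) (𝟙 M) rfl
        ?_).trans (Ext.mk₀_id_comp _)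
      ext e
      exact f.grM_eq e
  · rintro ⟨c, hc⟩
    -- The condition on the classes lets `c` extend to `E` with the identity on `M`; the subfactors
    -- `L` and `N` only see the restriction `c`.
    obtain ⟨φ, hι, hπ⟩ := A.pushExtension.exists_hom_of_cocycle_comp_eq B.pushExtension c.iso.hom (𝟙 M)
      (by rw [Ext.mk₀_id_comp]; exact hc)
    have h₁ : ∀ z : A.E₁, φ z.1 = (c.iso.hom z : B.E₁).1 := fun z =>
      (congrArg (fun f : A.G₁.G ⟶ B.E => f z) hι).symm
    refine nonempty_filteredIso_of_linearMap φ.hom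
      (fun e => congrArg (fun f : A.E ⟶ M => f e) hπ) (fun e he => ?_) (fun n => ?_)
    · refine ⟨(h₁ ⟨e, he⟩).symm ▸ Subtype.prop _, ?_⟩
      refine Eq.trans ?_ (c.π_hom ⟨e, he⟩)
      change B.grL _ = B.grL (Submodule.Quotient.mk _)
      congr 2
      exact Subtype.ext (h₁ ⟨e, he⟩)
    · exact (h₁ (A.G₁.ι n)).trans (congrArg Subtype.val (c.hom_ι n))

/-- Filtered isomorphism in terms of the extensions `0 ← E / E₂ ← E ← N ← 0`. -/
lemma nonempty_filteredIso_iff_pull : Nonempty (FilteredIso A B) ↔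
    ∃ c : OneExtension.Congruence A.G₀ B.G₀,
      (Ext.mk₀ c.iso.hom).comp B.pullExtension.cocycle (zero_add 1) = A.pullExtension.cocycle := by
  constructor
  · rintro ⟨f⟩
    let φ : A.G₀.G ⟶ B.G₀.G := ModuleCat.ofHom
      (A.E₂.mapQ B.E₂ f.α.toLinearMap (fun e he => (f.mem₂ e).2 he))
    refine ⟨.ofHom φ ?_ ?_, ?_⟩
    · ext l
      obtain ⟨z, rfl⟩ := A.grL.surjective l
      obtain ⟨z, rfl⟩ := Submodule.Quotient.mk_surjective _ z
      change φ (A.G₀.ι _) = B.G₀.ι _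
      rw [G₀_ι_grL, ← f.grL_eq _ z.2, G₀_ι_grL]
      rfl
    · ext z
      obtain ⟨e, rfl⟩ := Submodule.Quotient.mk_surjective _ z
      exact f.grM_eq e
    · refine (A.pullExtension.cocycle_naturality B.pullExtension (𝟙 N) (ModuleCat.ofHom f.α.toLinearMap) φ ?_
        rfl).symm.trans (Ext.comp_mk₀_id _)
      ext n
      have := f.grN_eq _ (A.grN.symm n).2
      rw [← LinearEquiv.eq_symm_apply] at this
      rw [LinearEquiv.apply_symm_apply] at this
      exact (congrArg Subtype.val this).symm
  · rintro ⟨c, hc⟩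
    -- Here `φ` lifts `c` and is the identity on `N`; the subfactors `M` and `L` are visible in `E /
    -- E₂`.
    obtain ⟨φ, hι, hπ⟩ := A.pullExtension.exists_hom_of_cocycle_comp_eq B.pullExtension (𝟙 N) c.iso.hom
      (by rw [Ext.comp_mk₀_id]; exact hc.symm)
    have h₀ : ∀ e : A.E, B.toG₀ (φ e) = c.iso.hom (A.toG₀ e) := fun e =>
      congrArg (fun f : A.E ⟶ B.G₀.G => f e) hπ
    refine nonempty_filteredIso_of_linearMap φ.hom (fun e => ?_)
      (fun e he => grL_eq_of_congruence c (h₀ e) he)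
      (fun n => (congrArg (fun f : N ⟶ B.E => f n) hι).symm)
    rw [← G₀_π_toG₀]
    erw [h₀]
    rw [c.π_hom, G₀_π_toG₀]

end TwoExtensionModule

/-! ### Fiber products over `M` and translation by a class of `Ext¹(M, N)` -/

namespace TwoExtensionModule

variable {D : Type u} [Ring D] {M L N : ModuleCat.{v} D} {A B : TwoExtensionModule M L N}

/-- The fiber product over `M` of a `2`-extension module and a `1`-extension of `M` by `N`. -/
def fiberProduct (A : TwoExtensionModule M L N) (X : OneExtension M N) :
    Submodule D (A.E × X.G) :=
  LinearMap.eqLocus (A.upper.π.hom.comp (LinearMap.fst D A.E X.G))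
    (X.π.hom.comp (LinearMap.snd D A.E X.G))

lemma mem_fiberProduct {X : OneExtension M N} {z : A.E × X.G} :
    z ∈ A.fiberProduct X ↔ A.grM (Submodule.Quotient.mk z.1) = X.π z.2 := Iff.rfl

/-- The fiber product `E ×_M X` as an extension of `M` by `E₁ × N`. -/
def fiberProductUpper (A : TwoExtensionModule M L N) (X : OneExtension M N) :
    OneExtension M (ModuleCat.of D (A.E₁ × N)) :=
  OneExtension.ofLinearMaps (G := ModuleCat.of D (A.fiberProduct X))
    ((LinearMap.prodMap A.E₁.subtype X.ι.hom).codRestrict _ (fun z => by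
      rw [mem_fiberProduct]
      exact ((A.mem_E₁_iff _).1 z.1.2).trans (X.π_ι z.2).symm))
    (X.π.hom ∘ₗ LinearMap.snd D A.E X.G ∘ₗ Submodule.subtype _)
    (fun a b h => Prod.ext (Subtype.ext (congrArg (fun z => z.1.1) h))
      (X.ι_injective (congrArg (fun z => z.1.2) h)))
    (fun m => by
      obtain ⟨x, rfl⟩ := X.π_surjective m
      obtain ⟨e, he⟩ := A.upper.π_surjective (X.π x)
      exact ⟨⟨(e, x), he⟩, rfl⟩)
    (by
      rintro ⟨⟨e, x⟩, h⟩
      rw [mem_fiberProduct] at h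
      constructor
      · intro hx
        replace hx : X.π x = 0 := hx
        obtain ⟨n, rfl⟩ := (X.exact x).1 hx
        exact ⟨(⟨e, (A.mem_E₁_iff e).2 (h.trans hx)⟩, n), rfl⟩
      · rintro ⟨z, hz⟩
        rw [← hz]
        exact X.π_ι z.2)

/-- The fiber product `E ×_M X` as an extension of `E / E₂` by `N × N`. -/
def fiberProductLower (A : TwoExtensionModule M L N) (X : OneExtension M N) :
    OneExtension A.G₀.G (ModuleCat.of D (N × N)) :=
  OneExtension.ofLinearMaps (G := ModuleCat.of D (A.fiberProduct X))
    ((LinearMap.prodMap A.lower.ι.hom X.ι.hom).codRestrict _ (fun z => by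
      refine mem_fiberProduct.2 ?_
      exact ((A.mem_E₁_iff _).1 (A.le (A.grN.symm z.1).2)).trans (X.π_ι z.2).symm))
    (A.lower.π.hom ∘ₗ LinearMap.fst D A.E X.G ∘ₗ Submodule.subtype _)
    (fun a b h => Prod.ext (A.lower.ι_injective (congrArg (fun z => z.1.1) h))
      (X.ι_injective (congrArg (fun z => z.1.2) h)))
    (fun m => by
      obtain ⟨e, rfl⟩ := A.lower.π_surjective m
      obtain ⟨x, hx⟩ := X.π_surjective (A.upper.π e)
      exact ⟨⟨(e, x), hx.symm⟩, rfl⟩)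
    (by
      rintro ⟨⟨e, x⟩, h⟩
      rw [mem_fiberProduct] at h
      constructor
      · intro he
        obtain ⟨n, rfl⟩ := (A.lower.exact e).1 he
        obtain ⟨n', rfl⟩ := (X.exact x).1
          (h.symm.trans ((A.mem_E₁_iff _).1 (A.le (A.grN.symm n).2)))
        exact ⟨(n, n'), rfl⟩
      · rintro ⟨z, hz⟩
        rw [← hz]
        exact A.lower.π_ι z.1)

/-- The `2`-extension module given by a surjection `q : E → M`, a surjection `l : ker q → L` and an
injection `j : N → E` whose image is the kernel of `l`. -/
def ofChain (E : ModuleCat.{v} D) (j : N →ₗ[D] E) (q : E →ₗ[D] M) (l : LinearMap.ker q →ₗ[D] L)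
    (hj : Function.Injective j) (hq : Function.Surjective q) (hl : Function.Surjective l)
    (hjq : ∀ n, q (j n) = 0) (hjl : ∀ z, l z = 0 ↔ z.1 ∈ LinearMap.range j) :
    TwoExtensionModule M L N where
  E := E
  E₁ := LinearMap.ker q
  E₂ := LinearMap.range j
  le := by rintro _ ⟨n, rfl⟩; exact hjq n
  grM := q.quotKerEquivOfSurjective hq
  grL := (Submodule.quotEquivOfEq _ _ (by ext z; exact (hjl z).symm)).trans
    (l.quotKerEquivOfSurjective hl)
  grN := (LinearEquiv.ofInjective j hj).symm

variable [Small.{v} D]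

/-- `B` is the translate of `A` by `ξ ∈ Ext¹(M, N)`: after a congruence `A.G₁ ≅ B.G₁`, the classes
in `Ext¹(M, B.G₁)` differ by `ξ ∘ ι`. -/
def IsTranslate (ξ : Ext M N 1) (A B : TwoExtensionModule M L N) : Prop :=
  ∃ c : OneExtension.Congruence A.G₁ B.G₁,
    ξ.comp (Ext.mk₀ B.G₁.ι) (add_zero 1) +
      A.pushExtension.cocycle.comp (Ext.mk₀ c.iso.hom) (add_zero 1) = B.pushExtension.cocycle

/-- Translates can be recognized on the extensions `0 ← E / E₂ ← E ← N ← 0`. -/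
lemma isTranslate_of_pull (ξ : Ext M N 1) (g : OneExtension.Congruence A.G₀ B.G₀)
    (hg : (Ext.mk₀ A.G₀.π).comp ξ (zero_add 1) + A.pullExtension.cocycle =
      (Ext.mk₀ g.iso.hom).comp B.pullExtension.cocycle (zero_add 1)) : IsTranslate ξ A B := by
  obtain ⟨X, rfl⟩ := OneExtension.exists_cocycle_eq ξ
  let p₁ : ModuleCat.of D (N × N) ⟶ N := ModuleCat.ofHom (LinearMap.fst D N N)
  let p₂ : ModuleCat.of D (N × N) ⟶ N := ModuleCat.ofHom (LinearMap.snd D N N)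
  -- The two components of the class of the fiber product, as an extension by `N × N`, are the class
  -- of `A` and the pullback of `ξ`.
  have h₁ : (A.fiberProductLower X).cocycle.comp (Ext.mk₀ p₁) (add_zero 1) =
      A.pullExtension.cocycle := by
    rw [(A.fiberProductLower X).cocycle_naturality A.pullExtension p₁
      (ModuleCat.ofHom (LinearMap.fst D A.E X.G ∘ₗ Submodule.subtype _)) (𝟙 _) rfl rfl,
      Ext.mk₀_id_comp]
  have h₂ : (A.fiberProductLower X).cocycle.comp (Ext.mk₀ p₂) (add_zero 1) =
      (Ext.mk₀ A.G₀.π).comp X.cocycle (zero_add 1) :=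
    (A.fiberProductLower X).cocycle_naturality X p₂
      (ModuleCat.ofHom (LinearMap.snd D A.E X.G ∘ₗ Submodule.subtype _)) A.G₀.π rfl
      (by ext z; exact z.2.symm)
  -- Baer sum: pushing along the addition `N × N → N` gives the left side of `hg`, so addition on `N
  -- × N` and `g` on the quotients extend to a map into `B.E`.
  obtain ⟨φ, hι, hπ⟩ := (A.fiberProductLower X).exists_hom_of_cocycle_comp_eq B.pullExtension
    (p₂ + p₁) g.iso.hom (by rw [Ext.mk₀_add, Ext.comp_add, h₁, h₂, hg])
  let ψ : A.fiberProduct X →ₗ[D] B.E := φ.hom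
  have hψι : ∀ n n' : N, ψ (⟨(A.lower.ι n, X.ι n'), ((A.fiberProductLower X).ι (n, n')).2⟩ :
      A.fiberProduct X) = B.lower.ι (n' + n) := fun n n' =>
    (congrArg (fun f : ModuleCat.of D (N × N) ⟶ B.E => f (n, n')) hι).symm
  have hψπ : ∀ z : A.fiberProduct X, B.toG₀ (ψ z) = g.iso.hom (A.toG₀ z.1.1) := fun z =>
    congrArg (fun f : ModuleCat.of D (A.fiberProduct X) ⟶ B.G₀.G => f z) hπ
  let j₁ : A.E₁ →ₗ[D] A.fiberProduct X :=
    (A.fiberProductUpper X).ι.hom ∘ₗ LinearMap.inl D A.E₁ N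
  let j₂ : N →ₗ[D] A.fiberProduct X :=
    (A.fiberProductUpper X).ι.hom ∘ₗ LinearMap.inr D A.E₁ N
  have hj₁ : ∀ z : A.E₁, ∃ h : ψ (j₁ z) ∈ B.E₁,
      B.grL (Submodule.Quotient.mk ⟨ψ (j₁ z), h⟩) = A.grL (Submodule.Quotient.mk z) := fun z =>
    grL_eq_of_congruence g (hψπ (j₁ z)) z.2
  have hψj₂ : ∀ n, ψ (j₂ n) = (B.G₁.ι n : B.E₁).1 := fun n => by
    refine Eq.trans ?_ ((hψι 0 n).trans (congrArg B.lower.ι (add_zero n)))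
    refine congrArg ψ (Subtype.ext (Prod.ext ?_ rfl))
    exact (map_zero A.lower.ι.hom).symm
  -- On `E₁ × 0` the map `φ` gives the required congruence `c`; on `0 × N` it is `B.G₁.ι`.
  let c : A.G₁.G ⟶ B.G₁.G := ModuleCat.ofHom
    ((ψ ∘ₗ j₁).codRestrict B.E₁ (fun z => (hj₁ z).1))
  have hc : A.G₁.ι ≫ c = B.G₁.ι := by
    ext n
    refine Subtype.ext ?_
    refine Eq.trans ?_ ((hψι n 0).trans (congrArg B.lower.ι (zero_add n)))
    refine congrArg ψ (Subtype.ext (Prod.ext rfl rfl))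
  refine ⟨.ofHom c hc (by ext z; exact (hj₁ z).2), ?_⟩
  let q₁ : ModuleCat.of D (A.E₁ × N) ⟶ A.G₁.G := ModuleCat.ofHom (LinearMap.fst D A.E₁ N)
  let q₂ : ModuleCat.of D (A.E₁ × N) ⟶ N := ModuleCat.ofHom (LinearMap.snd D A.E₁ N)
  have h₃ : (A.fiberProductUpper X).cocycle.comp (Ext.mk₀ q₁) (add_zero 1) =
      A.pushExtension.cocycle := by
    rw [(A.fiberProductUpper X).cocycle_naturality A.pushExtension q₁
      (ModuleCat.ofHom (LinearMap.fst D A.E X.G ∘ₗ Submodule.subtype _)) (𝟙 _) rfl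
      (by ext z; exact z.2), Ext.mk₀_id_comp]
  have h₄ : (A.fiberProductUpper X).cocycle.comp (Ext.mk₀ q₂) (add_zero 1) = X.cocycle := by
    rw [(A.fiberProductUpper X).cocycle_naturality X q₂
      (ModuleCat.ofHom (LinearMap.snd D A.E X.G ∘ₗ Submodule.subtype _)) (𝟙 _) rfl rfl,
      Ext.mk₀_id_comp]
  -- The same `φ` is a ladder for the other structure, over `(z, n) ↦ ι n + c z` and the identity of
  -- `M`. Comparing classes, whose components are now the class of `A` and `ξ`, gives the
  -- translation formula.
  have h₅ := (A.fiberProductUpper X).cocycle_naturality B.pushExtension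
    (q₂ ≫ B.G₁.ι + q₁ ≫ c) φ (𝟙 _)
    (by
      refine ModuleCat.hom_ext (LinearMap.ext fun z => ?_)
      change (B.G₁.ι z.2 : B.E₁).1 + ψ (j₁ z.1) = ψ ((A.fiberProductUpper X).ι z)
      rw [← hψj₂, ← map_add]
      refine congrArg ψ (Subtype.ext (Prod.ext ?_ ?_))
      · exact zero_add _
      · change X.ι z.2 + X.ι 0 = X.ι z.2
        rw [map_zero, add_zero])
    (by
      ext z
      refine (congrArg B.G₀.π (hψπ z)).trans ((g.π_hom _).trans ?_)
      exact z.2)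
  rw [Ext.mk₀_id_comp, Ext.mk₀_add, Ext.comp_add, ← Ext.mk₀_comp_mk₀, ← Ext.mk₀_comp_mk₀,
    ← Ext.comp_assoc_of_third_deg_zero, ← Ext.comp_assoc_of_third_deg_zero, h₃, h₄] at h₅
  exact h₅

end TwoExtensionModule

/-! ### 2-extension modules built from an extension class -/

namespace OneExtension

variable {D : Type u} [Ring D] {M L N : ModuleCat.{v} D}

/-- The identification of the submodule of a `1`-extension with the kernel of the projection. -/
def kerEquiv (X : OneExtension M N) : N ≃ₗ[D] LinearMap.ker X.π.hom :=
  LinearEquiv.ofBijective (X.ι.hom.codRestrict _ X.π_ι)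
    ⟨fun _ _ h => X.ι_injective (congrArg Subtype.val h), fun z => by
      obtain ⟨n, hn⟩ := (X.exact z.1).1 z.2
      exact ⟨n, Subtype.ext hn⟩⟩

lemma kerEquiv_coe (X : OneExtension M N) (n : N) : (X.kerEquiv n).1 = X.ι n := rfl

lemma ι_kerEquiv_symm (X : OneExtension M N) (z : LinearMap.ker X.π.hom) :
    X.ι (X.kerEquiv.symm z) = z.1 := by
  rw [← kerEquiv_coe, LinearEquiv.apply_symm_apply]

/-- The `2`-extension module given by an extension of `M` by the middle term of `G₁`. -/
def push (G₁ : OneExtension L N) (X : OneExtension M G₁.G) : TwoExtensionModule M L N :=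
  TwoExtensionModule.ofChain X.G (X.ι.hom ∘ₗ G₁.ι.hom) X.π.hom
    (G₁.π.hom ∘ₗ X.kerEquiv.symm.toLinearMap)
    (X.ι_injective.comp G₁.ι_injective) X.π_surjective
    (G₁.π_surjective.comp X.kerEquiv.symm.surjective) (fun _ => X.π_ι _)
    (fun z => by
      refine (G₁.exact _).trans ⟨?_, ?_⟩
      · rintro ⟨n, hn⟩
        exact ⟨n, (congrArg X.ι hn).trans (X.ι_kerEquiv_symm z)⟩
      · rintro ⟨n, hn⟩
        exact ⟨n, X.ι_injective (hn.trans (X.ι_kerEquiv_symm z).symm)⟩)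

/-- The step `E₁` is the kernel of `X.π`, so `kerEquiv` is the congruence, and the identity of `X.G`
extends it. -/
lemma inducedByPush_push [Small.{v} D] (G₁ : OneExtension L N) (X : OneExtension M G₁.G) :
    InducedByPush G₁ (G₁.push X) X.cocycle := by
  let θ : G₁.G ⟶ (G₁.push X).G₁.G := ModuleCat.ofHom X.kerEquiv.toLinearMap
  refine ⟨.ofHom θ rfl ?_, ?_⟩
  · ext z
    change G₁.π (X.kerEquiv.symm (X.kerEquiv z)) = G₁.π z
    rw [LinearEquiv.symm_apply_apply]
  · exact (X.cocycle_naturality (G₁.push X).pushExtension θ (𝟙 X.G) (𝟙 M) rfl rfl).trans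
      (Ext.mk₀_id_comp _)

/-- The `2`-extension module given by an extension of the middle term of `G₀` by `N`. -/
def pull (G₀ : OneExtension M L) (Y : OneExtension G₀.G N) : TwoExtensionModule M L N :=
  TwoExtensionModule.ofChain Y.G Y.ι.hom (G₀.π.hom ∘ₗ Y.π.hom)
    (G₀.kerEquiv.symm.toLinearMap ∘ₗ
      (Y.π.hom ∘ₗ Submodule.subtype _).codRestrict (LinearMap.ker G₀.π.hom) (fun z => z.2))
    Y.ι_injective (G₀.π_surjective.comp Y.π_surjective)
    (G₀.kerEquiv.symm.surjective.comp (fun z => by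
      obtain ⟨y, hy⟩ := Y.π_surjective z.1
      exact ⟨⟨y, (congrArg G₀.π hy).trans z.2⟩, Subtype.ext hy⟩))
    (fun n => (congrArg G₀.π (Y.π_ι n)).trans (map_zero G₀.π.hom))
    (fun z => by
      refine G₀.kerEquiv.symm.map_eq_zero_iff.trans (Subtype.ext_iff.trans ?_)
      exact Y.exact z.1)

/-- `Y.π` descends to a congruence from `E / E₂` to `G₀`, covered by the identity of `Y.G`. -/
lemma inducedByPull_pull [Small.{v} D] (G₀ : OneExtension M L) (Y : OneExtension G₀.G N) :
    InducedByPull G₀ (G₀.pull Y) Y.cocycle := by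
  let θ : (G₀.pull Y).G₀.G ⟶ G₀.G := ModuleCat.ofHom
    ((G₀.pull Y).E₂.liftQ (Y.π.hom : (G₀.pull Y).E →ₗ[D] G₀.G) (by rintro _ ⟨n, rfl⟩; exact Y.π_ι n))
  refine ⟨.ofHom θ ?_ ?_, ?_⟩
  · ext l
    obtain ⟨z, rfl⟩ := (G₀.pull Y).grL.surjective l
    obtain ⟨z, rfl⟩ := Submodule.Quotient.mk_surjective _ z
    refine (congrArg θ ((G₀.pull Y).G₀_ι_grL z)).trans ?_
    exact (G₀.ι_kerEquiv_symm ⟨Y.π z.1, z.2⟩).symm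
  · ext z
    obtain ⟨z, rfl⟩ := Submodule.Quotient.mk_surjective _ z
    rfl
  · exact ((G₀.pull Y).pullExtension.cocycle_naturality Y (𝟙 N) (𝟙 Y.G : (G₀.pull Y).E ⟶ Y.G) θ rfl rfl).symm.trans
      (Ext.comp_mk₀_id _)

end OneExtension

end

/-! ### Quotients and torsors obtained from relations -/

/-- A correspondence which is total in both directions and compatible with two equivalence
relations induces a bijection between the quotients. -/
lemma exists_equiv_quotient {α β : Type*} (s : Setoid α) (t : Setoid β) (I : α → β → Prop)
    (hα : ∀ a, ∃ b, I a b) (hβ : ∀ b, ∃ a, I a b)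
    (hs : ∀ {a a' b}, I a b → (I a' b ↔ s a a')) (ht : ∀ {a b b'}, I a b → (I a b' ↔ t b b')) :
    ∃ Φ : Quotient s ≃ Quotient t,
      ∀ a b, Φ (Quotient.mk s a) = Quotient.mk t b ↔ I a b := by
  choose f hf using hα
  choose g hg using hβ
  refine ⟨⟨Quotient.map f ?_, Quotient.map g ?_, ?_, ?_⟩, ?_⟩
  · exact fun a a' h => (ht (hf a)).1 ((hs (hf a')).2 (s.symm h))
  · exact fun b b' h => (hs (hg b)).1 ((ht (hg b')).2 (t.symm h))
  · rintro ⟨a⟩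
    exact Quotient.sound ((hs (hg _)).1 (hf a))
  · rintro ⟨b⟩
    exact Quotient.sound ((ht (hf _)).1 (hg b))
  · intro a b
    exact Quotient.eq.trans (ht (hf a)).symm

/-- A family of relations on `α`, indexed by an additive group and behaving like the graphs of the
translations of a transitive action up to an equivalence relation with constant stabilizer `H`,
makes the quotient of `α` a torsor under the quotient by `H`. -/
lemma exists_addTorsor_quotient {V α : Type*} [AddCommGroup V] (H : AddSubgroup V) (s : Setoid α)
    [Nonempty (Quotient s)] (R : V → α → α → Prop)
    (hadd : ∀ {v w a b c}, R v a b → R w b c → R (w + v) a c)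
    (hneg : ∀ {v a b}, R v a b → R (-v) b a)
    (hzero : ∀ {a b}, R 0 a b ↔ s a b) (hex : ∀ v a, ∃ b, R v a b)
    (htrans : ∀ a b, ∃ v, R v a b) (hstab : ∀ {v a}, R v a a ↔ v ∈ H) :
    ∃ _ : AddTorsor (V ⧸ H) (Quotient s), ∀ v a b, R v a b →
      (QuotientAddGroup.mk v : V ⧸ H) +ᵥ Quotient.mk s a = Quotient.mk s b := by
  -- The class reached depends only on `v` modulo `H` and on the class of `a`: the path from `b`
  -- back to `a`, across to `a'` and on to `b'` has label `w - v`, and a loop at `b` cancels this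
  -- label.
  have huniq : ∀ {v w a a' b b'}, -v + w ∈ H → s a a' → R v a b → R w a' b' → s b b' := by
    intro v w a a' b b' hvw ha hv hw
    rw [← hzero]
    have h₁ : R (-v + w) b b := hstab.2 hvw
    have h₂ : R (w - v) b b' := by
      simpa [sub_eq_add_neg] using hadd (hadd (hneg hv) (hzero.2 ha)) hw
    simpa [sub_eq_add_neg, add_comm] using hadd (hneg h₁) h₂
  -- Here the path closes up to a loop at `b` with label `-v + w`, which therefore lies in the
  -- stabilizer.
  have hdiff : ∀ {v w a a' b b'}, s a a' → s b b' → R v a b → R w a' b' → -v + w ∈ H := by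
    intro v w a a' b b' ha hb hv hw
    refine (hstab (a := b)).1 ?_
    simpa [add_comm] using
      hadd (hadd (hadd (hneg hv) (hzero.2 ha)) hw) (hzero.2 (s.symm hb))
  choose t ht using hex
  choose d hd using htrans
  let act : V ⧸ H → Quotient s → Quotient s := Quotient.map₂ t (fun v w hvw a a' ha =>
    huniq (QuotientAddGroup.leftRel_apply.1 hvw) ha (ht v a) (ht w a'))
  let sub : Quotient s → Quotient s → V ⧸ H := Quotient.map₂ (fun a b => d b a)
    (fun a a' ha b b' hb => QuotientAddGroup.leftRel_apply.2 (hdiff hb ha (hd b a) (hd b' a')))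
  have hact : ∀ v a b, R v a b → act (QuotientAddGroup.mk v) (Quotient.mk s a) =
      Quotient.mk s b := fun v a b h =>
    Quotient.sound (huniq (by simp [H.zero_mem]) (s.refl a) (ht v a) h)
  refine ⟨{
    vadd := act
    zero_vadd := ?_
    add_vadd := ?_
    vsub := sub
    vsub_vadd' := ?_
    vadd_vsub' := ?_
    nonempty := inferInstance }, hact⟩
  · rintro ⟨v⟩ ⟨w⟩ ⟨a⟩
    exact hact (v + w) a _ (hadd (ht w a) (ht v _))
  · rintro ⟨a⟩
    exact hact 0 a a (hzero.2 (s.refl a))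
  · rintro ⟨a⟩ ⟨b⟩
    exact hact (d b a) b a (hd b a)
  · rintro ⟨v⟩ ⟨a⟩
    exact Quotient.sound (QuotientAddGroup.leftRel_apply.2
      (hdiff (s.refl a) (s.refl _) (hd a (t v a)) (ht v a)))

/-! ### Composition of classes with morphisms -/

section

variable {D : Type u} [Ring D] [Small.{v} D] {M L N : ModuleCat.{v} D}

lemma ext_comp_mk₀_comp_mk₀ {X Y Z W : ModuleCat.{v} D} {n : ℕ} (x : Ext X Y n) (f : Y ⟶ Z)
    (g : Z ⟶ W) : (x.comp (Ext.mk₀ f) (add_zero n)).comp (Ext.mk₀ g) (add_zero n) =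
      x.comp (Ext.mk₀ (f ≫ g)) (add_zero n) := by
  rw [Ext.comp_assoc_of_third_deg_zero, Ext.mk₀_comp_mk₀]

lemma ext_comp_mk₀_injective {X Y Z : ModuleCat.{v} D} {n : ℕ} (e : Y ≅ Z) {x y : Ext X Y n}
    (h : x.comp (Ext.mk₀ e.hom) (add_zero n) = y.comp (Ext.mk₀ e.hom) (add_zero n)) : x = y := by
  have := congrArg (fun z => Ext.comp z (Ext.mk₀ e.inv) (add_zero n)) h
  simpa only [ext_comp_mk₀_comp_mk₀, Iso.hom_inv_id, Ext.comp_mk₀_id] using this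

lemma ext_mk₀_comp_injective {X Y Z : ModuleCat.{v} D} {n : ℕ} (e : X ≅ Y) {x y : Ext Y Z n}
    (h : (Ext.mk₀ e.hom).comp x (zero_add n) = (Ext.mk₀ e.hom).comp y (zero_add n)) : x = y := by
  have := congrArg (fun z => (Ext.mk₀ e.inv).comp z (zero_add n)) h
  simpa only [Ext.mk₀_comp_mk₀_assoc, Iso.inv_hom_id, Ext.mk₀_id_comp] using this

lemma OneExtension.Congruence.cocycle_eq {X Y : OneExtension M N} (e : Congruence X Y) :
    X.cocycle = Y.cocycle := by
  have := X.cocycle_naturality Y (𝟙 N) e.iso.hom (𝟙 M) (by rw [e.comm_ι, Category.id_comp])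
    (by rw [e.comm_π, Category.comp_id])
  rwa [Ext.comp_mk₀_id, Ext.mk₀_id_comp] at this

lemma mem_homComp {η' : Ext L N 1} {ξ : Ext M N 1} :
    ξ ∈ homComp M η' ↔ ∃ φ : M ⟶ L, (Ext.mk₀ φ).comp η' (zero_add 1) = ξ := Iff.rfl

lemma mem_compHom {η : Ext M L 1} {ξ : Ext M N 1} :
    ξ ∈ compHom η N ↔ ∃ ψ : L ⟶ N, η.comp (Ext.mk₀ ψ) (add_zero 1) = ξ := Iff.rfl

/-! ### Translation: group law, transitivity and stabilizers -/

namespace TwoExtensionModule.IsTranslate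

variable {A B C : TwoExtensionModule M L N} {ξ ξ' : Ext M N 1}

lemma zero_iff : IsTranslate 0 A B ↔ Nonempty (FilteredIso A B) := by
  rw [nonempty_filteredIso_iff_push]
  simp only [IsTranslate, Ext.zero_comp, zero_add]

lemma add (h : IsTranslate ξ A B) (h' : IsTranslate ξ' B C) : IsTranslate (ξ' + ξ) A C := by
  obtain ⟨c, hc⟩ := h
  obtain ⟨c', hc'⟩ := h'
  refine ⟨c.trans c', ?_⟩
  rw [← hc', ← hc, Ext.add_comp, Ext.add_comp, ext_comp_mk₀_comp_mk₀, ext_comp_mk₀_comp_mk₀,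
    c'.comm_ι, add_assoc]
  rfl

lemma neg (h : IsTranslate ξ A B) : IsTranslate (-ξ) B A := by
  obtain ⟨c, hc⟩ := h
  refine ⟨c.symm, ?_⟩
  rw [← hc, Ext.add_comp, ext_comp_mk₀_comp_mk₀, ext_comp_mk₀_comp_mk₀, c.symm.comm_ι]
  change _ + (_ + A.pushExtension.cocycle.comp (Ext.mk₀ (c.iso.hom ≫ c.iso.inv)) _) = _
  rw [Iso.hom_inv_id, Ext.comp_mk₀_id, Ext.neg_comp, neg_add_cancel_left]

lemma of_inducedByPush {G₁ : OneExtension L N} {x : Ext M G₁.G 1} (hA : InducedByPush G₁ A x)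
    (hB : InducedByPush G₁ B (ξ.comp (Ext.mk₀ G₁.ι) (add_zero 1) + x)) : IsTranslate ξ A B := by
  obtain ⟨e, he⟩ := hA
  obtain ⟨e', he'⟩ := hB
  change _ = A.pushExtension.cocycle at he
  change _ = B.pushExtension.cocycle at he'
  refine ⟨e.symm.trans e', ?_⟩
  rw [← he, ← he', Ext.add_comp, ext_comp_mk₀_comp_mk₀, ext_comp_mk₀_comp_mk₀, e'.comm_ι]
  change _ + x.comp (Ext.mk₀ (e.iso.hom ≫ e.iso.inv ≫ e'.iso.hom)) _ = _
  rw [Iso.hom_inv_id_assoc]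

/-- Translation is defined on the push side; the passage from the pull side is
`isTranslate_of_pull`, applied to the comparison of both quotients through `G₀`. -/
lemma of_inducedByPull {G₀ : OneExtension M L} {y : Ext G₀.G N 1} (hA : InducedByPull G₀ A y)
    (hB : InducedByPull G₀ B ((Ext.mk₀ G₀.π).comp ξ (zero_add 1) + y)) : IsTranslate ξ A B := by
  obtain ⟨e, he⟩ := hA
  obtain ⟨e', he'⟩ := hB
  change _ = A.pullExtension.cocycle at he
  change _ = B.pullExtension.cocycle at he'
  refine isTranslate_of_pull ξ (e.trans e'.symm) ?_
  rw [← he, ← he', Ext.mk₀_comp_mk₀_assoc]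
  change _ = (Ext.mk₀ ((e.iso.hom ≫ e'.iso.inv) ≫ e'.iso.hom)).comp _ _
  rw [Category.assoc, Iso.inv_hom_id, Category.comp_id, Ext.comp_add, Ext.mk₀_comp_mk₀_assoc,
    e.comm_π]

/-- `2`-extension modules with the same cocycles are translates of each other. -/
lemma exists_of_cocycle_eq (h₀ : A.G₀.cocycle = B.G₀.cocycle) (h₁ : A.G₁.cocycle = B.G₁.cocycle) :
    ∃ ξ, IsTranslate ξ A B := by
  obtain ⟨c⟩ := OneExtension.nonempty_congruence h₁
  -- Both classes have the same image in `Ext¹(M, L)`, so their difference comes from `Ext¹(M, N)`.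
  obtain ⟨ξ, hξ⟩ := Ext.covariant_sequence_exact₂ M B.G₁.shortExact
    (B.pushExtension.cocycle - A.pushExtension.cocycle.comp (Ext.mk₀ c.iso.hom) (add_zero 1)) (by
      change Ext.comp _ (Ext.mk₀ B.G₁.π) _ = 0
      rw [sub_eq_add_neg, Ext.add_comp, Ext.neg_comp, ext_comp_mk₀_comp_mk₀, c.comm_π,
        pushExtension_cocycle_comp, pushExtension_cocycle_comp, h₀, add_neg_cancel])
  refine ⟨ξ, c, ?_⟩
  change ξ.comp (Ext.mk₀ B.G₁.ι) _ = _ at hξ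
  rw [hξ, sub_add_cancel]

/-- Self-congruences of `G₁` have the form `1 + π ≫ ψ ≫ ι` and move the class of `A` by `(η ∘ ψ) ∘
ι`, where `η` is the class of `G₀`. So `ξ` stabilizes `A` exactly when some `ξ + η ∘ ψ` lies in the
kernel of `ι_*`, which is `Hom(M, L) ∘ η'` with `η'` the class of `G₁`. -/
lemma self_iff : IsTranslate ξ A A ↔
    ξ ∈ homComp M A.G₁.cocycle ⊔ compHom A.G₀.cocycle N := by
  let e : OneExtension.Congruence A.G₁ A.G₁ :=
    .ofHom (𝟙 _) (Category.comp_id _) (Category.id_comp _)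
  have key : ∀ (ζ : Ext M N 1) (ψ : L ⟶ N), ζ.comp (Ext.mk₀ A.G₁.ι) (add_zero 1) +
      A.pushExtension.cocycle.comp (Ext.mk₀ (𝟙 A.G₁.G + A.G₁.π ≫ ψ ≫ A.G₁.ι)) (add_zero 1) =
      (ζ + A.G₀.cocycle.comp (Ext.mk₀ ψ) (add_zero 1)).comp (Ext.mk₀ A.G₁.ι) (add_zero 1) +
        A.pushExtension.cocycle := by
    intro ζ ψ
    rw [Ext.mk₀_add, Ext.comp_add, Ext.comp_mk₀_id, ← ext_comp_mk₀_comp_mk₀,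
      pushExtension_cocycle_comp, ← ext_comp_mk₀_comp_mk₀, Ext.add_comp]
    abel
  rw [AddSubgroup.mem_sup]
  constructor
  · rintro ⟨c, hc⟩
    obtain ⟨ψ, hψ⟩ := e.exists_eq_add c
    rw [hψ] at hc
    replace hc := (key ξ ψ).symm.trans hc
    rw [add_eq_right] at hc
    obtain ⟨φ₀, hφ⟩ := Ext.covariant_sequence_exact₁ M A.G₁.shortExact _ hc (zero_add 1)
    obtain ⟨φ, rfl⟩ := (Ext.mk₀_bijective _ _).2 φ₀
    refine ⟨_, mem_homComp.2 ⟨φ, rfl⟩, _, mem_compHom.2 ⟨-ψ, rfl⟩, ?_⟩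
    change (Ext.mk₀ φ).comp A.G₁.cocycle _ = _ at hφ
    rw [hφ, Ext.mk₀_neg, Ext.comp_neg, add_neg_cancel_right]
  · rintro ⟨_, ⟨φ, rfl⟩, _, ⟨ψ, rfl⟩, rfl⟩
    -- The sign makes the self-congruence cancel `η ∘ ψ`; the remaining `φ ∘ η'` is killed by `ι`.
    refine ⟨e.addHom (-ψ), (key _ (-ψ)).trans ?_⟩
    change (((Ext.mk₀ φ).comp A.G₁.cocycle (zero_add 1) +
      A.G₀.cocycle.comp (Ext.mk₀ ψ) (add_zero 1)) + _).comp _ _ + _ = _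
    have hz : A.G₁.cocycle.comp (Ext.mk₀ A.G₁.ι) (add_zero 1) = 0 :=
      A.G₁.shortExact.extClass_comp
    rw [Ext.mk₀_neg, Ext.comp_neg, add_neg_cancel_right, Ext.comp_assoc_of_third_deg_zero, hz,
      Ext.comp_zero, zero_add]

end TwoExtensionModule.IsTranslate

variable {η : Ext M L 1} {η' : Ext L N 1}

/-! ### The correspondence with the fiber of `π_*` -/

section Push

variable {G₁ : OneExtension L N}

lemma InducedByPush.comp_π {A : TwoExtensionModule M L N} {x : Ext M G₁.G 1}
    (h : InducedByPush G₁ A x) : x.comp (Ext.mk₀ G₁.π) (add_zero 1) = A.G₀.cocycle := by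
  obtain ⟨e, he⟩ := h
  rw [← A.pushExtension_cocycle_comp, ← e.comm_π, ← ext_comp_mk₀_comp_mk₀, he]
  rfl

lemma exists_inducedByPush (hG : G₁.cocycle = η') (A : AdmissibleModule η η') :
    ∃ x : PushFiber G₁ η, InducedByPush G₁ A.1 x.1 := by
  obtain ⟨e⟩ := OneExtension.nonempty_congruence (hG.trans A.2.2.symm)
  have h : InducedByPush G₁ A.1
      (A.1.pushExtension.cocycle.comp (Ext.mk₀ e.iso.inv) (add_zero 1)) := by
    refine ⟨e, ?_⟩
    rw [ext_comp_mk₀_comp_mk₀, Iso.inv_hom_id, Ext.comp_mk₀_id]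
    rfl
  exact ⟨⟨_, h.comp_π.trans A.2.1⟩, h⟩

lemma exists_admissibleModule_of_push (hG : G₁.cocycle = η') (x : PushFiber G₁ η) :
    ∃ A : AdmissibleModule η η', InducedByPush G₁ A.1 x.1 := by
  obtain ⟨X, hX⟩ := OneExtension.exists_cocycle_eq x.1
  have h := G₁.inducedByPush_push X
  rw [hX] at h
  exact ⟨⟨_, h.comp_π.symm.trans x.2, h.choose.cocycle_eq.symm.trans hG⟩, h⟩

/-- Modules induced by the same class are translates by `0`; conversely congruences with `G₁`
compose. -/
lemma InducedByPush.iff_filteredIso {A B : TwoExtensionModule M L N} {x : Ext M G₁.G 1}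
    (h : InducedByPush G₁ A x) :
    InducedByPush G₁ B x ↔ Nonempty (TwoExtensionModule.FilteredIso A B) := by
  constructor
  · intro h'
    rw [← TwoExtensionModule.IsTranslate.zero_iff]
    exact .of_inducedByPush h (by rwa [Ext.zero_comp, zero_add])
  · rw [TwoExtensionModule.nonempty_filteredIso_iff_push]
    rintro ⟨c, hc⟩
    obtain ⟨e, he⟩ := h
    refine ⟨e.trans c, ?_⟩
    change _ = A.pushExtension.cocycle at he
    refine Eq.trans ?_ hc
    rw [← he, ext_comp_mk₀_comp_mk₀]
    rfl

/-- Only the congruence between `G₁` and `A.G₁` is free. Changing it by `ψ : L ⟶ N` has the same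
effect as adding `(η ∘ ψ) ∘ ι` to `y`, because `y` lies over `η`. -/
lemma InducedByPush.iff_orbitRel {A : TwoExtensionModule M L N} {x y : PushFiber G₁ η}
    (h : InducedByPush G₁ A x.1) :
    InducedByPush G₁ A y.1 ↔ AddAction.orbitRel (compHom η N) (PushFiber G₁ η) x y := by
  rw [AddAction.orbitRel_apply, AddAction.mem_orbit_iff]
  have key : ∀ (e : OneExtension.Congruence G₁ A.G₁) (ψ : L ⟶ N), y.1.comp
      (Ext.mk₀ (e.iso.hom + G₁.π ≫ ψ ≫ A.G₁.ι)) (add_zero 1) =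
      ((η.comp (Ext.mk₀ ψ) (add_zero 1)).comp (Ext.mk₀ G₁.ι) (add_zero 1) + y.1).comp
        (Ext.mk₀ e.iso.hom) (add_zero 1) := by
    intro e ψ
    rw [Ext.mk₀_add, Ext.comp_add, ← ext_comp_mk₀_comp_mk₀, y.2, Ext.add_comp,
      ext_comp_mk₀_comp_mk₀ _ G₁.ι, e.comm_ι, ext_comp_mk₀_comp_mk₀, add_comm]
  obtain ⟨e, he⟩ := h
  constructor
  · rintro ⟨e', he'⟩
    obtain ⟨ψ, hψ⟩ := e.exists_eq_add e'
    refine ⟨⟨_, mem_compHom.2 ⟨ψ, rfl⟩⟩, Subtype.ext ?_⟩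
    refine ext_comp_mk₀_injective e.iso ((key e ψ).symm.trans ?_)
    rw [← hψ]
    exact he'.trans he.symm
  · rintro ⟨⟨_, ψ, rfl⟩, hψ⟩
    have hx : (η.comp (Ext.mk₀ ψ) (add_zero 1)).comp (Ext.mk₀ G₁.ι) (add_zero 1) + y.1 = x.1 :=
      congrArg Subtype.val hψ
    exact ⟨e.addHom ψ, (key e ψ).trans (by rw [hx]; exact he)⟩

end Push

/-! ### The correspondence with the fiber of `ι^*` -/

section Pull

variable {G₀ : OneExtension M L}

lemma InducedByPull.ι_comp {A : TwoExtensionModule M L N} {y : Ext G₀.G N 1}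
    (h : InducedByPull G₀ A y) : (Ext.mk₀ G₀.ι).comp y (zero_add 1) = A.G₁.cocycle := by
  obtain ⟨e, he⟩ := h
  rw [← A.comp_pullExtension_cocycle, ← e.comm_ι, ← Ext.mk₀_comp_mk₀_assoc, he]
  rfl

lemma exists_inducedByPull (hG : G₀.cocycle = η) (A : AdmissibleModule η η') :
    ∃ y : PullFiber G₀ η', InducedByPull G₀ A.1 y.1 := by
  obtain ⟨e⟩ := OneExtension.nonempty_congruence (A.2.1.trans hG.symm)
  have h : InducedByPull G₀ A.1
      ((Ext.mk₀ e.iso.inv).comp A.1.pullExtension.cocycle (zero_add 1)) := by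
    refine ⟨e, ?_⟩
    rw [Ext.mk₀_comp_mk₀_assoc, Iso.hom_inv_id, Ext.mk₀_id_comp]
    rfl
  exact ⟨⟨_, h.ι_comp.trans A.2.2⟩, h⟩

lemma exists_admissibleModule_of_pull (hG : G₀.cocycle = η) (y : PullFiber G₀ η') :
    ∃ A : AdmissibleModule η η', InducedByPull G₀ A.1 y.1 := by
  obtain ⟨Y, hY⟩ := OneExtension.exists_cocycle_eq y.1
  have h := G₀.inducedByPull_pull Y
  rw [hY] at h
  exact ⟨⟨_, h.choose.cocycle_eq.trans hG, h.ι_comp.symm.trans y.2⟩, h⟩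

lemma InducedByPull.iff_filteredIso {A B : TwoExtensionModule M L N} {y : Ext G₀.G N 1}
    (h : InducedByPull G₀ A y) :
    InducedByPull G₀ B y ↔ Nonempty (TwoExtensionModule.FilteredIso A B) := by
  constructor
  · intro h'
    rw [← TwoExtensionModule.IsTranslate.zero_iff]
    exact .of_inducedByPull h (by rwa [Ext.comp_zero, zero_add])
  · rw [TwoExtensionModule.nonempty_filteredIso_iff_pull]
    rintro ⟨c, hc⟩
    obtain ⟨e, he⟩ := h
    refine ⟨c.symm.trans e, ext_mk₀_comp_injective c.iso ?_⟩
    refine Eq.trans ?_ (he.trans hc.symm)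
    rw [Ext.mk₀_comp_mk₀_assoc]
    change (Ext.mk₀ (c.iso.hom ≫ c.iso.inv ≫ e.iso.hom)).comp _ _ = _
    rw [Iso.hom_inv_id_assoc]

/-- Congruences between `A.G₀` and `G₀` differ by some `φ : M ⟶ L`, and since `y` restricts to `η'`
on `L`, the change amounts to adding the pullback of `φ ∘ η'` to `y`. -/
lemma InducedByPull.iff_orbitRel {A : TwoExtensionModule M L N} {x y : PullFiber G₀ η'}
    (h : InducedByPull G₀ A x.1) :
    InducedByPull G₀ A y.1 ↔ AddAction.orbitRel (homComp M η') (PullFiber G₀ η') x y := by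
  rw [AddAction.orbitRel_apply, AddAction.mem_orbit_iff]
  have key : ∀ (e : OneExtension.Congruence A.G₀ G₀) (φ : M ⟶ L),
      (Ext.mk₀ (e.iso.hom + A.G₀.π ≫ φ ≫ G₀.ι)).comp y.1 (zero_add 1) =
      (Ext.mk₀ e.iso.hom).comp ((Ext.mk₀ G₀.π).comp ((Ext.mk₀ φ).comp η' (zero_add 1))
        (zero_add 1) + y.1) (zero_add 1) := by
    intro e φ
    rw [Ext.mk₀_add, Ext.add_comp, ← Category.assoc, ← Ext.mk₀_comp_mk₀_assoc, y.2, Ext.comp_add,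
      Ext.mk₀_comp_mk₀_assoc, Ext.mk₀_comp_mk₀_assoc, ← e.comm_π, Category.assoc, add_comm]
  obtain ⟨e, he⟩ := h
  constructor
  · rintro ⟨e', he'⟩
    obtain ⟨φ, hφ⟩ := e.exists_eq_add e'
    refine ⟨⟨_, mem_homComp.2 ⟨φ, rfl⟩⟩, Subtype.ext ?_⟩
    refine ext_mk₀_comp_injective e.iso ((key e φ).symm.trans ?_)
    rw [← hφ]
    exact he'.trans he.symm
  · rintro ⟨⟨_, φ, rfl⟩, hφ⟩
    have hx : (Ext.mk₀ G₀.π).comp ((Ext.mk₀ φ).comp η' (zero_add 1)) (zero_add 1) + y.1 = x.1 :=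
      congrArg Subtype.val hφ
    exact ⟨e.addHom φ, (key e φ).trans (by rw [hx]; exact he)⟩

end Pull

/-- The translate is found in the fiber for the extension `A.G₁` itself, where `ξ` acts, and is then
realised by a module. -/
lemma exists_admissibleModule_isTranslate (ξ : Ext M N 1) (A : AdmissibleModule η η') :
    ∃ B : AdmissibleModule η η', TwoExtensionModule.IsTranslate ξ A.1 B.1 := by
  obtain ⟨x, hx⟩ := exists_inducedByPush A.2.2 A
  obtain ⟨B, hB⟩ := exists_admissibleModule_of_push A.2.2 (ξ +ᵥ x)
  exact ⟨B, .of_inducedByPush hx hB⟩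

end

theorem mainTheorem2 {D : Type u} [Ring D] [Small.{v} D] {M L N : ModuleCat.{v} D}
    (η : Ext M L 1) (η' : Ext L N 1) :
    -- `ExtMod(η, η')` is a principal homogeneous space, for the action that the actions of
    -- `Ext¹(M, N)` on the two fibers induce
    (Nonempty (ExtMod η η') →
      ∃ _ : AddTorsor (ExtOfCocycles η η') (ExtMod η η'),
        (∀ G₁ : OneExtension L N, G₁.cocycle = η' →
          ∀ (ξ : Ext M N 1) (x : PushFiber G₁ η) (A B : AdmissibleModule η η'),
            InducedByPush G₁ A.1 x.1 → InducedByPush G₁ B.1 (ξ +ᵥ x).1 →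
              (QuotientAddGroup.mk ξ : ExtOfCocycles η η') +ᵥ ExtMod.mk A = ExtMod.mk B) ∧
        (∀ G₀ : OneExtension M L, G₀.cocycle = η →
          ∀ (ξ : Ext M N 1) (y : PullFiber G₀ η') (A B : AdmissibleModule η η'),
            InducedByPull G₀ A.1 y.1 → InducedByPull G₀ B.1 (ξ +ᵥ y).1 →
              (QuotientAddGroup.mk ξ : ExtOfCocycles η η') +ᵥ ExtMod.mk A = ExtMod.mk B)) ∧
    -- `ExtMod(η, η') ≅ (π_*)⁻¹(η) / (η ∘ Hom(L, N))`
    (∀ G₁ : OneExtension L N, G₁.cocycle = η' →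
      ∃ Φ : ExtMod η η' ≃ AddAction.orbitRel.Quotient (compHom η N) (PushFiber G₁ η),
        ∀ (A : AdmissibleModule η η') (x : PushFiber G₁ η),
          Φ (ExtMod.mk A) = Quotient.mk _ x ↔ InducedByPush G₁ A.1 x.1) ∧
    -- `ExtMod(η, η') ≅ (ι^*)⁻¹(η') / (Hom(M, L) ∘ η')`
    (∀ G₀ : OneExtension M L, G₀.cocycle = η →
      ∃ Ψ : ExtMod η η' ≃ AddAction.orbitRel.Quotient (homComp M η') (PullFiber G₀ η'),
        ∀ (A : AdmissibleModule η η') (y : PullFiber G₀ η'),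
          Ψ (ExtMod.mk A) = Quotient.mk _ y ↔ InducedByPull G₀ A.1 y.1) := by
  refine ⟨fun hne => ?_, fun G₁ hG₁ => ?_, fun G₀ hG₀ => ?_⟩
  · have : Nonempty (Quotient (admissibleSetoid η η')) := hne
    -- `IsTranslate` involves no auxiliary `G₁` or `G₀`, so one action serves all of them and both
    -- compatibilities are instances of `hT`.
    obtain ⟨T, hT⟩ := exists_addTorsor_quotient (homComp M η' ⊔ compHom η N)
      (admissibleSetoid η η') (fun ξ A B => TwoExtensionModule.IsTranslate ξ A.1 B.1)
      (fun h h' => h.add h') (fun h => h.neg) TwoExtensionModule.IsTranslate.zero_iff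
      exists_admissibleModule_isTranslate
      (fun A B => TwoExtensionModule.IsTranslate.exists_of_cocycle_eq (A.2.1.trans B.2.1.symm) (A.2.2.trans B.2.2.symm))
      (fun {ξ A} => by rw [TwoExtensionModule.IsTranslate.self_iff, A.2.1, A.2.2])
    exact ⟨T, fun G₁ _ ξ x A B hA hB => hT ξ A B (.of_inducedByPush hA hB),
      fun G₀ _ ξ y A B hA hB => hT ξ A B (.of_inducedByPull hA hB)⟩
  · exact exists_equiv_quotient (admissibleSetoid η η')
      (AddAction.orbitRel (compHom η N) (PushFiber G₁ η))
      (fun A x => InducedByPush G₁ A.1 x.1) (exists_inducedByPush hG₁)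
      (exists_admissibleModule_of_push hG₁) (fun h => h.iff_filteredIso)
      (fun h => h.iff_orbitRel)
  · exact exists_equiv_quotient (admissibleSetoid η η')
      (AddAction.orbitRel (homComp M η') (PullFiber G₀ η'))
      (fun A y => InducedByPull G₀ A.1 y.1) (exists_inducedByPull hG₀)
      (exists_admissibleModule_of_pull hG₀) (fun h => h.iff_filteredIso)
      (fun h => h.iff_orbitRel)
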